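/- Let $H$ be a complex separable Hilbert space. A countable indexed family $(v_n)_{n\in J}$ in $H$ is called a Riesz basis for a subspace $V\subseteq H$ if $V$ is the closed linear span of $(v_n)_{n\in J}$ and there are constants $A,B>0$ such that for every $(a_n)\in\ell^2(J)$ the series $\sum_{n} a_n v_n$ converges unconditionally and $$A\sum_{n\in J}|a_n|^2\le\Big\|\sum_{n\in J}a_nv_n\Big\|^2\le B\sum_{n\in J}|a_n|^2 .$$ Let $\mathcal G$ be a countably infinite abelian group of unitary operators on $H$. For a finite list $X=(x_1,\dots,x_k)$ of vectors in $H$, let $\mathcal G(X)$ denote the family $(g x_j)$ indexed by $(g,j)\in\mathcal G\times\{1,\dots,k\}$. Theorem. Let $r<s$, let $X=(x_1,\dots,x_r)$ and $Y=(y_1,\dots,y_s)$ be vectors in $H$, and let $V_0$ and $V_1$ be the closed linear spans of $\mathcal G(X)$ and $\mathcal G(Y)$. Suppose that $V_0\subseteq V_1$ and that $\mathcal G(X)$ and $\mathcal G(Y)$ are Riesz bases for $V_0$ and $V_1$ respectively. Let $W_0$ be a closed linear subspace of $V_1$ with $V_0+W_0=V_1$ and $V_0\cap W_0=\{0\}$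 (the sum need not be orthogonal). Then there exist vectors $z_1,\dots,z_{s-r}\in W_0$ such that $\mathcal G(\Gamma)$, with $\Gamma=(z_1,\dots,z_{s-r})$, is a Riesz basis for $W_0$ if and only if $g(W_0)\subseteq W_0$ for every $g\in\mathcal G$. -/

import Mathlib

/-- The indexed family `v` is a Riesz basis for the subspace `V`: `V` is the closed linear span of
`v`, and there are constants `A, B > 0` such that for every square-summable coefficient family `a`
the series `∑ a n • v n` converges (unconditionally) and
`A ∑ |a n|² ≤ ‖∑ a n • v n‖² ≤ B ∑ |a n|²`. -/
def IsRieszBasisFor {H : Type*} [NormedAddCommGroup H] [InnerProductSpace ℂ H]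
    {J : Type*} (v : J → H) (V : Submodule ℂ H) : Prop :=
  V = (Submodule.span ℂ (Set.range v)).topologicalClosure ∧
  ∃ A B : ℝ, 0 < A ∧ 0 < B ∧ ∀ a : J → ℂ, Summable (fun n => ‖a n‖ ^ 2) →
    Summable (fun n => a n • v n) ∧
    A * ∑' n, ‖a n‖ ^ 2 ≤ ‖∑' n, a n • v n‖ ^ 2 ∧
    ‖∑' n, a n • v n‖ ^ 2 ≤ B * ∑' n, ‖a n‖ ^ 2

/-- The family `(g x_j)`, indexed by the pairs `(g, j)`, for a group `G` of unitary operators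
(linear isometric bijections of `H`, with composition as product) and vectors `x_j`. -/
def orbitFamily {H : Type*} [NormedAddCommGroup H] [InnerProductSpace ℂ H]
    (G : Subgroup (H ≃ₗᵢ[ℂ] H)) {k : ℕ} (x : Fin k → H) : G × Fin k → H :=
  fun p => (p.1 : H ≃ₗᵢ[ℂ] H) (x p.2)

/-! If `W₀` is the closed span of full orbits, it is invariant because each `g` permutes the orbit
vectors and is continuous.

For the converse, write `s = r + k` and let `K` be ℓ² of `G × Fin (r + k)` with the translation
representation `U`. The synthesis operator `S` of `Y` identifies `K` with `V₁`, intertwining `U`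
with `G`; put `A = S⁻¹ V₀` and `C = S⁻¹ W₀`. The synthesis of `X`, precomposed with restriction to
the first `r` blocks and pulled back through `S`, is an equivariant operator `T` on `K` with range
`A` whose kernel `N` is spanned by the last `k` blocks.

The key fact is that the commutant of `U` is a finite von Neumann algebra, with trace `∑ i, ⟪e (1,
i), T e (1, i)⟫`. Hence polar decomposition can be done with a unitary factor
(`IsEquivariant.exists_unitary_polar`), and an equivariant unitary `u` carries `ker T` onto `(range
T)ᗮ = Aᗮ` (`IsEquivariant.exists_unitary_ker`). The oblique projection `P` onto `C` along `A` maps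
`Aᗮ` isomorphically onto `C` and is equivariant exactly because `C` and `A` are invariant. So `S P
u` carries the orthonormal basis of `N`, which consists of `k` orbits, to a Riesz basis of `W₀`
consisting of `k` orbits. -/

/-! ### Operators commuting with a unitary representation. -/

section Equivariant

open ContinuousLinearMap

variable {Γ : Type*} [Group Γ] {K : Type*} [NormedAddCommGroup K] [InnerProductSpace ℂ K]

/-- `T` commutes with every operator `U g` of the unitary representation `U`. -/
def IsEquivariant (U : Γ →* (K ≃ₗᵢ[ℂ] K)) (T : K →L[ℂ] K) : Prop :=
  ∀ g x, T (U g x) = U g (T x)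

theorem unitary_rep_inv_apply (U : Γ →* (K ≃ₗᵢ[ℂ] K)) (g : Γ) (x : K) : U g⁻¹ (U g x) = x := by
  rw [map_inv]
  exact (U g).symm_apply_apply x

theorem unitary_rep_apply_inv (U : Γ →* (K ≃ₗᵢ[ℂ] K)) (g : Γ) (x : K) : U g (U g⁻¹ x) = x := by
  simpa only [inv_inv] using unitary_rep_inv_apply U g⁻¹ x

theorem inner_unitary_rep_left (U : Γ →* (K ≃ₗᵢ[ℂ] K)) (g : Γ) (x y : K) :
    inner ℂ (U g x) y = inner ℂ x (U g⁻¹ y) := by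
  rw [← (U g).inner_map_map x (U g⁻¹ y), unitary_rep_apply_inv]

theorem HilbertBasis.clm_ext {J F : Type*} [NormedAddCommGroup F] [NormedSpace ℂ F]
    (e : HilbertBasis J ℂ K) {S T : K →L[ℂ] F} (h : ∀ n, S (e n) = T (e n)) : S = T := by
  refine ContinuousLinearMap.ext_on (s := Set.range e) ?_ ?_
  · rw [Submodule.dense_iff_topologicalClosure_eq_top]
    exact e.dense_span
  · rintro _ ⟨n, rfl⟩
    exact h n

theorem HilbertBasis.hasSum_norm_sq {J : Type*} (e : HilbertBasis J ℂ K) (x : K) :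
    HasSum (fun n => ‖inner ℂ (e n) x‖ ^ 2) (‖x‖ ^ 2) := by
  have h := (e.hasSum_inner_mul_inner x x).mapL Complex.reCLM
  convert h using 1
  · ext n
    rw [← inner_conj_symm x (e n), RCLike.conj_mul]
    simp [← Complex.ofReal_pow]
  · simp [← Complex.ofReal_pow]

variable [CompleteSpace K] {U : Γ →* (K ≃ₗᵢ[ℂ] K)}

theorem IsEquivariant.adjoint {T : K →L[ℂ] K} (hT : IsEquivariant U T) :
    IsEquivariant U (adjoint T) := by
  intro g x
  refine ext_inner_right ℂ fun y => ?_
  rw [adjoint_inner_left, inner_unitary_rep_left, inner_unitary_rep_left, adjoint_inner_left, hT]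

omit [CompleteSpace K] in
theorem IsEquivariant.comp {S T : K →L[ℂ] K} (hS : IsEquivariant U S) (hT : IsEquivariant U T) :
    IsEquivariant U (S ∘L T) := fun g x => by simp [hT g x, hS g]

/-- `T` commutes with `U g` and with its adjoint `U g⁻¹`, hence so does everything obtained from `T`
by functional calculus. -/
theorem IsEquivariant.abs {T : K →L[ℂ] K} (hT : IsEquivariant U T) :
    IsEquivariant U (CFC.abs T) := by
  intro g x
  have key : ∀ g, Commute T ((U g : K →L[ℂ] K)) := fun g => by
    ext x
    exact hT g x
  have hstar : star (U g : K →L[ℂ] K) = (U g⁻¹ : K →L[ℂ] K) := by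
    rw [star_eq_adjoint]
    symm
    rw [eq_adjoint_iff]
    intro x y
    have h := inner_unitary_rep_left U g⁻¹ x y
    rwa [inv_inv] at h
  have h := (key g).cfcAbs_left (by rw [hstar]; exact key g⁻¹)
  exact congr($(h.eq) x)

theorem norm_cfcAbs_apply (T : K →L[ℂ] K) (x : K) : ‖CFC.abs T x‖ = ‖T x‖ := by
  have hsa : IsSelfAdjoint (CFC.abs T) := (CFC.abs_nonneg T).isSelfAdjoint
  have h : inner ℂ (CFC.abs T x) (CFC.abs T x) = inner ℂ (T x) (T x) := by
    rw [← adjoint_inner_right, ← adjoint_inner_right, ← star_eq_adjoint, hsa.star_eq,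
      ← star_eq_adjoint]
    exact congr(inner ℂ x ($(CFC.abs_mul_abs T) x))
  rw [← sq_eq_sq₀ (norm_nonneg _) (norm_nonneg _)]
  simpa [inner_self_eq_norm_sq_to_K, ← Complex.ofReal_pow] using congr(Complex.re $h)

theorem inner_cfcAbs_left (T : K →L[ℂ] K) (x y : K) :
    inner ℂ (CFC.abs T x) y = inner ℂ x (CFC.abs T y) := by
  have hsa : IsSelfAdjoint (CFC.abs T) := (CFC.abs_nonneg T).isSelfAdjoint
  rw [← adjoint_inner_right, ← star_eq_adjoint, hsa.star_eq]

omit [CompleteSpace K] in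
theorem isEquivariant_starProjection {N : Submodule ℂ K} [N.HasOrthogonalProjection]
    (hN : ∀ g, ∀ x ∈ N, U g x ∈ N) : IsEquivariant U N.starProjection := by
  intro g x
  refine Submodule.eq_starProjection_of_mem_of_inner_eq_zero
    (hN g _ (N.starProjection_apply_mem x)) fun w hw => ?_
  rw [← map_sub, inner_unitary_rep_left]
  exact Submodule.starProjection_inner_eq_zero _ _ (hN _ _ hw)

omit [CompleteSpace K] in
theorem orthogonal_invariant {N : Submodule ℂ K} (hN : ∀ g, ∀ x ∈ N, U g x ∈ N) (g : Γ) (x : K)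
    (hx : x ∈ Nᗮ) : U g x ∈ Nᗮ := by
  rw [Submodule.mem_orthogonal'] at hx ⊢
  intro y hy
  rw [inner_unitary_rep_left]
  exact hx _ (hN _ _ hy)

/-! ### Finiteness of the commutant of a multiple of the regular representation. -/

section Trace

variable {ι : Type*} [Fintype ι] {e : HilbertBasis (Γ × ι) ℂ K}

/-- The trace property `τ (T* T) = τ (T T*)` of the commutant of a multiple of the regular
representation. -/
theorem sum_norm_sq_adjoint (he : ∀ g p, U g (e p) = e (g * p.1, p.2))
    {T : K →L[ℂ] K} (hT : IsEquivariant U T) :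
    ∑ i, ‖adjoint T (e (1, i))‖ ^ 2 = ∑ i, ‖T (e (1, i))‖ ^ 2 := by
  have expand : ∀ x : K, ‖x‖ ^ 2 = ∑ j, ∑' g, ‖inner ℂ (e (g, j)) x‖ ^ 2 := by
    intro x
    have h := (e.hasSum_norm_sq x)
    rw [← h.tsum_eq, ← (Equiv.prodComm ι Γ).tsum_eq]
    have hs : Summable fun p : ι × Γ => ‖inner ℂ (e (Equiv.prodComm ι Γ p)) x‖ ^ 2 :=
      (Equiv.prodComm ι Γ).summable_iff.mpr h.summable
    rw [hs.tsum_prod, tsum_fintype]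
    rfl
  simp_rw [expand]
  rw [Finset.sum_comm]
  refine Finset.sum_congr rfl fun j _ => Finset.sum_congr rfl fun i _ => ?_
  -- Moving `U g⁻¹` across the inner product turns the coefficient of `T*` at `g⁻¹` into the
  -- conjugate of that of `T` at `g`.
  rw [← (Equiv.inv Γ).tsum_eq]
  refine tsum_congr fun g => ?_
  have h1 : e (g⁻¹, j) = U g⁻¹ (e (1, j)) := by rw [he, mul_one]
  have h2 : e (g, i) = U g (e (1, i)) := by rw [he, mul_one]
  rw [Equiv.inv_apply, adjoint_inner_right, h1, hT, inner_unitary_rep_left, inv_inv, ← h2,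
    norm_inner_symm]

omit [CompleteSpace K] [Fintype ι] in
theorem isEquivariant_ext (he : ∀ g p, U g (e p) = e (g * p.1, p.2)) {S T : K →L[ℂ] K}
    (hS : IsEquivariant U S) (hT : IsEquivariant U T) (h : ∀ i, S (e (1, i)) = T (e (1, i))) :
    S = T := by
  refine e.clm_ext fun ⟨g, i⟩ => ?_
  have h2 : e (g, i) = U g (e (1, i)) := by rw [he, mul_one]
  rw [h2, hS, hT, h]

/-- The commutant of a finite multiple of the regular representation is a finite von Neumann
algebra: its isometries are surjective. -/
theorem IsEquivariant.surjective_of_isometry (he : ∀ g p, U g (e p) = e (g * p.1, p.2))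
    {T : K →L[ℂ] K} (hT : IsEquivariant U T) (hiso : ∀ x, ‖T x‖ = ‖x‖) :
    Function.Surjective T := by
  have hTT : ContinuousLinearMap.adjoint T ∘L T = 1 := (norm_map_iff_adjoint_comp_self T).mp hiso
  have hle : ∀ x, ‖ContinuousLinearMap.adjoint T x‖ ≤ ‖x‖ := by
    intro x
    have hn : ‖T‖ ≤ 1 := T.opNorm_le_bound zero_le_one fun x => by simp [hiso]
    calc ‖ContinuousLinearMap.adjoint T x‖ ≤ ‖ContinuousLinearMap.adjoint T‖ * ‖x‖ := le_opNorm _ _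
      _ ≤ 1 * ‖x‖ := by rw [LinearIsometryEquiv.norm_map]; gcongr
      _ = ‖x‖ := one_mul _
  have hsum := sum_norm_sq_adjoint he hT
  simp_rw [hiso] at hsum
  -- `T*` is a contraction, so equality of the finite sums forces equality in each term.
  have heq := (Finset.sum_eq_sum_iff_of_le fun i _ =>
    pow_le_pow_left₀ (norm_nonneg _) (hle (e (1, i))) 2).mp hsum
  have hone : T ∘L ContinuousLinearMap.adjoint T = 1 := by
    refine isEquivariant_ext he (hT.comp hT.adjoint) (fun g x => rfl) fun i => ?_
    have h := heq i (Finset.mem_univ i)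
    set v := e (1, i)
    rw [← sub_eq_zero, ← norm_eq_zero, ← sq_eq_zero_iff]
    have h1 : inner ℂ ((T ∘L ContinuousLinearMap.adjoint T) v) v = inner ℂ (ContinuousLinearMap.adjoint T v) (ContinuousLinearMap.adjoint T v) := by
      rw [coe_comp, Function.comp_apply, ← adjoint_inner_right]
    have h2 : ‖(T ∘L ContinuousLinearMap.adjoint T) v‖ = ‖ContinuousLinearMap.adjoint T v‖ := hiso _
    change ‖(T ∘L ContinuousLinearMap.adjoint T) v - v‖ ^ 2 = 0
    -- The expansion is `‖T* v‖² - 2 ‖T* v‖² + ‖v‖²`, and `‖T* v‖ = ‖v‖`.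
    rw [@norm_sub_sq ℂ, h1, h2, inner_self_eq_norm_sq, h]
    ring
  intro y
  exact ⟨ContinuousLinearMap.adjoint T y, congr($hone y)⟩

end Trace

end Equivariant

/-! ### Maximal equivariant partial isometries and unitary polar decomposition. -/

section IsometricRelation

open ContinuousLinearMap

variable {Γ : Type*} [Group Γ] {K : Type*} [NormedAddCommGroup K] [InnerProductSpace ℂ K]

/-- A linear relation invariant under the representation `U` whose pairs have equal norms. The
maximal ones are the graphs of the maximal partial isometries commuting with `U`. -/
structure IsIsometricRelation (U : Γ →* (K ≃ₗᵢ[ℂ] K)) (E : Submodule ℂ (K × K)) : Prop where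
  invariant : ∀ g, ∀ p ∈ E, (U g p.1, U g p.2) ∈ E
  norm_eq : ∀ p ∈ E, ‖p.1‖ = ‖p.2‖

variable {U : Γ →* (K ≃ₗᵢ[ℂ] K)}

theorem IsIsometricRelation.exists_maximal {E₀ : Submodule ℂ (K × K)}
    (h₀ : IsIsometricRelation U E₀) :
    ∃ E, E₀ ≤ E ∧ Maximal (IsIsometricRelation U) E := by
  refine zorn_le_nonempty₀ {E | IsIsometricRelation U E} (fun c hc hchain F hF => ?_) E₀ h₀
  have hmem : ∀ p, p ∈ sSup c ↔ ∃ E ∈ c, p ∈ E := fun p =>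
    Submodule.mem_sSup_of_directed ⟨F, hF⟩ hchain.directedOn
  refine ⟨sSup c, ⟨fun g p hp => ?_, fun p hp => ?_⟩, fun E hE => le_sSup hE⟩
  · obtain ⟨E, hE, hpE⟩ := (hmem p).mp hp
    exact (hmem _).mpr ⟨E, hE, (hc hE).invariant g p hpE⟩
  · obtain ⟨E, hE, hpE⟩ := (hmem p).mp hp
    exact (hc hE).norm_eq p hpE

theorem IsIsometricRelation.sup {E F : Submodule ℂ (K × K)} (hE : IsIsometricRelation U E)
    (hF : IsIsometricRelation U F) (h₁ : ∀ p ∈ E, ∀ q ∈ F, inner ℂ p.1 q.1 = 0)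
    (h₂ : ∀ p ∈ E, ∀ q ∈ F, inner ℂ p.2 q.2 = 0) : IsIsometricRelation U (E ⊔ F) := by
  constructor
  · intro g p hp
    obtain ⟨a, ha, b, hb, rfl⟩ := Submodule.mem_sup.mp hp
    have := Submodule.add_mem_sup (hE.invariant g a ha) (hF.invariant g b hb)
    simpa using this
  · intro p hp
    obtain ⟨a, ha, b, hb, rfl⟩ := Submodule.mem_sup.mp hp
    have e₁ := norm_add_sq_eq_norm_sq_add_norm_sq_of_inner_eq_zero a.1 b.1 (h₁ a ha b hb)
    have e₂ := norm_add_sq_eq_norm_sq_add_norm_sq_of_inner_eq_zero a.2 b.2 (h₂ a ha b hb)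
    rw [hE.norm_eq a ha, hF.norm_eq b hb, ← e₂] at e₁
    simpa using (mul_self_inj (norm_nonneg _) (norm_nonneg _)).mp e₁

theorem IsIsometricRelation.topologicalClosure {E : Submodule ℂ (K × K)}
    (hE : IsIsometricRelation U E) : IsIsometricRelation U E.topologicalClosure := by
  constructor
  · intro g p hp
    exact map_mem_closure (f := fun p : K × K => (U g p.1, U g p.2)) (by fun_prop) hp
      fun q hq => hE.invariant g q hq
  · intro p hp
    have hc : IsClosed {p : K × K | ‖p.1‖ = ‖p.2‖} := isClosed_eq (by fun_prop) (by fun_prop)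
    exact closure_minimal hE.norm_eq hc hp

theorem IsIsometricRelation.comap_swap {E : Submodule ℂ (K × K)}
    (hE : IsIsometricRelation U E) :
    IsIsometricRelation U (E.comap (LinearEquiv.prodComm ℂ K K : K × K →ₗ[ℂ] K × K)) :=
  ⟨fun g _ hp => hE.invariant g _ hp, fun _ hp => (hE.norm_eq _ hp).symm⟩

/-- Exchanging domain and range lets every result on the range of a maximal relation be used for its
domain. -/
theorem maximal_comap_swap {E : Submodule ℂ (K × K)} (hE : Maximal (IsIsometricRelation U) E) :
    Maximal (IsIsometricRelation U)
      (E.comap (LinearEquiv.prodComm ℂ K K : K × K →ₗ[ℂ] K × K)) := by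
  refine ⟨hE.1.comap_swap, fun F hF hle p hp => ?_⟩
  exact hE.2 hF.comap_swap (fun q hq => hle (x := q.swap) (by simpa using hq)) (by simpa using hp)

variable [CompleteSpace K]

/-- The relation `{(|T| x, T x)}` underlying the polar decomposition of `T`. -/
theorem isIsometricRelation_polar {T : K →L[ℂ] K} (hT : IsEquivariant U T) :
    IsIsometricRelation U ((CFC.abs T).prod T : K →L[ℂ] K × K).range := by
  constructor
  · rintro g _ ⟨x, rfl⟩
    exact ⟨U g x, by simp [hT g x, hT.abs g x]⟩
  · rintro _ ⟨x, rfl⟩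
    exact norm_cfcAbs_apply T x

/-- For a maximal relation there is no nonzero equivariant operator between the orthogonal
complements of the domain and of the range. -/
theorem Maximal.inner_eq_zero {E : Submodule ℂ (K × K)}
    (hE : Maximal (IsIsometricRelation U) E) {S : K →L[ℂ] K} (hS : IsEquivariant U S)
    {x y : K} (hx : ∀ p ∈ E, inner ℂ p.1 x = 0) (hy : ∀ p ∈ E, inner ℂ p.2 y = 0) :
    inner ℂ (S x) y = 0 := by
  set D : Submodule ℂ K := E.map (LinearMap.fst ℂ K K)
  set R : Submodule ℂ K := E.map (LinearMap.snd ℂ K K)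
  have hD : ∀ g, ∀ x ∈ D, U g x ∈ D := by
    rintro g _ ⟨p, hp, rfl⟩
    exact ⟨_, hE.1.invariant g p hp, rfl⟩
  have hR : ∀ g, ∀ x ∈ R, U g x ∈ R := by
    rintro g _ ⟨p, hp, rfl⟩
    exact ⟨_, hE.1.invariant g p hp, rfl⟩
  have hxD : x ∈ Dᗮ := by
    rw [Submodule.mem_orthogonal]
    rintro _ ⟨p, hp, rfl⟩
    exact hx p hp
  have hyR : y ∈ Rᗮ := by
    rw [Submodule.mem_orthogonal]
    rintro _ ⟨p, hp, rfl⟩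
    exact hy p hp
  -- The compression of `S` to an operator from `Dᗮ` to `Rᗮ` has a polar relation orthogonal to `E`
  -- in both coordinates. By maximality that relation already lies in `E`, so `T x` lies in both `R`
  -- and `Rᗮ`.
  set T : K →L[ℂ] K := Rᗮ.starProjection ∘L S ∘L Dᗮ.starProjection
  have hT : IsEquivariant U T :=
    (isEquivariant_starProjection (orthogonal_invariant hR)).comp
      (hS.comp (isEquivariant_starProjection (orthogonal_invariant hD)))
  have hTD : ∀ d ∈ D, T d = 0 := by
    intro d hd
    have : Dᗮ.starProjection d = 0 :=
      Submodule.starProjection_orthogonal_apply_eq_zero hd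
    simp [T, this]
  have hTR : ∀ z, T z ∈ Rᗮ := fun z => Submodule.starProjection_apply_mem _ _
  have hsup : IsIsometricRelation U (E ⊔ ((CFC.abs T).prod T : K →L[ℂ] K × K).range) := by
    refine hE.1.sup (isIsometricRelation_polar hT) ?_ ?_
    · rintro p hp _ ⟨z, rfl⟩
      have h0 : CFC.abs T p.1 = 0 := by
        rw [← norm_eq_zero, norm_cfcAbs_apply, hTD p.1 ⟨p, hp, rfl⟩, norm_zero]
      change inner ℂ p.1 (CFC.abs T z) = 0
      rw [← inner_cfcAbs_left, h0, inner_zero_left]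
    · rintro p hp _ ⟨z, rfl⟩
      exact (Submodule.mem_orthogonal _ _).mp (hTR z) p.2 ⟨p, hp, rfl⟩
  have hmem : (CFC.abs T x, T x) ∈ E :=
    hE.2 hsup le_sup_left (Submodule.mem_sup_right ⟨x, rfl⟩)
  have hTx : T x = 0 := by
    rw [← inner_self_eq_zero (𝕜 := ℂ)]
    exact (Submodule.mem_orthogonal _ _).mp (hTR x) _ ⟨_, hmem, rfl⟩
  have hpx : Dᗮ.starProjection x = x := Submodule.starProjection_eq_self_iff.mpr hxD
  have hpy : Rᗮ.starProjection y = y := Submodule.starProjection_eq_self_iff.mpr hyR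
  rw [← hpy, ← Submodule.inner_starProjection_left_eq_right]
  change inner ℂ (Rᗮ.starProjection (S x)) y = 0
  have : T x = Rᗮ.starProjection (S x) := by simp [T, hpx]
  rw [← this, hTx, inner_zero_left]

/-- A maximal relation equals its closure, and the first projection is isometric on it since the
product carries the sup norm and both coordinates have equal norm. -/
theorem isClosed_fst_of_maximal {E : Submodule ℂ (K × K)}
    (hE : Maximal (IsIsometricRelation U) E) :
    IsClosed (E.map (LinearMap.fst ℂ K K) : Set K) := by
  have hcl : IsClosed (E : Set (K × K)) := by
    have : E.topologicalClosure = E :=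
      le_antisymm (hE.2 hE.1.topologicalClosure E.le_topologicalClosure) E.le_topologicalClosure
    rw [← this]
    exact E.isClosed_topologicalClosure
  let f : E →ₗᵢ[ℂ] K :=
    ⟨LinearMap.fst ℂ K K ∘ₗ E.subtype, fun p => by
      change ‖(p : K × K).1‖ = max ‖(p : K × K).1‖ ‖(p : K × K).2‖
      rw [← hE.1.norm_eq p p.2, max_self]⟩
  have : CompleteSpace E := hcl.completeSpace_coe
  have hr := f.isometry.isClosedEmbedding.isClosed_range
  convert hr using 1
  ext x
  simp [f]

/-- The isometry defined on the domain of a maximal relation, extended by zero. -/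
theorem exists_partialIsometry {E : Submodule ℂ (K × K)}
    (hE : Maximal (IsIsometricRelation U) E) :
    ∃ u : K →L[ℂ] K, ∀ p ∈ E, u p.1 = p.2 := by
  set D : Submodule ℂ K := E.map (LinearMap.fst ℂ K K)
  have : CompleteSpace D := (isClosed_fst_of_maximal hE).completeSpace_coe
  have huniq : ∀ p ∈ E, ∀ q ∈ E, p.1 = q.1 → p.2 = q.2 := by
    intro p hp q hq h
    have := hE.1.norm_eq _ (E.sub_mem hp hq)
    rw [Prod.fst_sub, Prod.snd_sub, h, sub_self, norm_zero] at this
    exact sub_eq_zero.mp (norm_eq_zero.mp this.symm)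
  choose f hf using fun d : D => d.2
  let v : D →ₗᵢ[ℂ] K :=
    { toFun := fun d => (f d).2
      map_add' := fun a b => by
        refine huniq _ (hf _).1 (f a + f b) (E.add_mem (hf a).1 (hf b).1) ?_
        exact (hf (a + b)).2.trans (congrArg₂ (· + ·) (hf a).2 (hf b).2).symm
      map_smul' := fun c a => by
        refine huniq _ (hf _).1 (c • f a) (E.smul_mem c (hf a).1) ?_
        exact (hf (c • a)).2.trans (congrArg (c • ·) (hf a).2).symm
      norm_map' := fun d => by
        change ‖(f d).2‖ = ‖(d : K)‖
        rw [← hE.1.norm_eq _ (hf d).1]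
        exact congrArg norm (hf d).2 }
  refine ⟨v.toContinuousLinearMap ∘L D.orthogonalProjectionOnto, fun p hp => ?_⟩
  have hpD : p.1 ∈ D := ⟨p, hp, rfl⟩
  have h1 : D.orthogonalProjectionOnto p.1 = ⟨p.1, hpD⟩ :=
    Submodule.orthogonalProjectionOnto_mem_subspace_eq_self (⟨p.1, hpD⟩ : D)
  change v (D.orthogonalProjectionOnto p.1) = p.2
  rw [h1]
  exact huniq _ (hf _).1 p hp (hf ⟨p.1, hpD⟩).2

variable {ι : Type*} [Fintype ι] {e : HilbertBasis (Γ × ι) ℂ K}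

/-- In a finite multiple of the regular representation, the range of a maximal relation has
trivial orthogonal complement. -/
theorem orthogonal_snd_of_maximal (he : ∀ g p, U g (e p) = e (g * p.1, p.2))
    {E : Submodule ℂ (K × K)} (hE : Maximal (IsIsometricRelation U) E) :
    (E.map (LinearMap.snd ℂ K K))ᗮ = ⊥ := by
  obtain ⟨u, hu⟩ := exists_partialIsometry hE
  set D : Submodule ℂ K := E.map (LinearMap.fst ℂ K K)
  set R : Submodule ℂ K := E.map (LinearMap.snd ℂ K K)
  have hcomplete : CompleteSpace D := (isClosed_fst_of_maximal hE).completeSpace_coe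
  have hR : ∀ g, ∀ x ∈ R, U g x ∈ R := by
    rintro g _ ⟨p, hp, rfl⟩
    exact ⟨_, hE.1.invariant g p hp, rfl⟩
  have hD : ∀ g, ∀ x ∈ D, U g x ∈ D := by
    rintro g _ ⟨p, hp, rfl⟩
    exact ⟨_, hE.1.invariant g p hp, rfl⟩
  have hun : ∀ d ∈ D, ‖u d‖ = ‖d‖ := by
    rintro _ ⟨p, hp, rfl⟩
    rw [LinearMap.fst_apply, hu p hp, hE.1.norm_eq p hp]
  have huR : ∀ d ∈ D, u d ∈ R := by
    rintro _ ⟨p, hp, rfl⟩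
    exact ⟨p, hp, (hu p hp).symm⟩
  have hug : ∀ g, ∀ d ∈ D, u (U g d) = U g (u d) := by
    rintro g _ ⟨p, hp, rfl⟩
    rw [LinearMap.fst_apply, hu p hp]
    exact hu _ (hE.1.invariant g p hp)
  -- `Z` is the range of the central support of the projection onto `Rᗮ`.
  set Z₀ : Submodule ℂ K :=
    Submodule.span ℂ {w | ∃ S : K →L[ℂ] K, IsEquivariant U S ∧ ∃ x ∈ Rᗮ, w = S x} with hZ₀
  set Z : Submodule ℂ K := Z₀.topologicalClosure with hZdef
  have hZS : ∀ S : K →L[ℂ] K, IsEquivariant U S → ∀ w ∈ Z, S w ∈ Z := by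
    intro S hS w hw
    refine map_mem_closure S.continuous hw fun a ha => ?_
    have hle : Z₀ ≤ Z₀.comap (S : K →ₗ[ℂ] K) := by
      rw [hZ₀, Submodule.span_le]
      rintro _ ⟨S', hS', x, hx, rfl⟩
      exact Submodule.subset_span ⟨S ∘L S', hS.comp hS', x, hx, rfl⟩
    exact hle ha
  have hRZ : Rᗮ ≤ Z := fun x hx =>
    Z₀.le_topologicalClosure (Submodule.subset_span ⟨1, fun _ _ => rfl, x, hx, rfl⟩)
  -- For `y ∈ Dᗮ` and `x ∈ Rᗮ`, the product `⟪y, S x⟫ = ⟪S* y, x⟫` vanishes by maximality, so `S x ∈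
  -- Dᗮᗮ = D`.
  have hZD : Z ≤ D := by
    refine Submodule.topologicalClosure_minimal _ ?_ (isClosed_fst_of_maximal hE)
    rw [hZ₀, Submodule.span_le]
    rintro _ ⟨S, hS, x, hx, rfl⟩
    rw [← D.orthogonal_orthogonal, SetLike.mem_coe, Submodule.mem_orthogonal]
    intro y hy
    rw [← adjoint_inner_left]
    refine hE.inner_eq_zero hS.adjoint (fun p hp => ?_) (fun p hp => ?_)
    · exact (Submodule.mem_orthogonal _ _).mp hy _ ⟨p, hp, rfl⟩
    · exact (Submodule.mem_orthogonal _ _).mp hx _ ⟨p, hp, rfl⟩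
  have hZg : ∀ g, ∀ w ∈ Z, U g w ∈ Z := by
    intro g w hw
    refine map_mem_closure (U g).continuous hw fun a ha => ?_
    have hle : Z₀ ≤ Z₀.comap ((U g).toLinearEquiv : K →ₗ[ℂ] K) := by
      rw [hZ₀, Submodule.span_le]
      rintro _ ⟨S, hS, x, hx, rfl⟩
      exact Submodule.subset_span
        ⟨S, hS, U g x, orthogonal_invariant hR g x hx, (hS g x).symm⟩
    exact hle ha
  have huD : IsEquivariant U (u ∘L D.starProjection) := by
    intro g x
    have h1 := isEquivariant_starProjection hD g x
    simp only [coe_comp, Function.comp_apply]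
    rw [h1, hug g _ (D.starProjection_apply_mem x)]
  have huZ : ∀ w ∈ Z, u w ∈ Z := by
    intro w hw
    have h1 := hZS _ huD w hw
    rwa [coe_comp, Function.comp_apply,
      Submodule.starProjection_eq_self_iff.mpr (hZD hw)] at h1
  have hzZ : ∀ x, Z.starProjection x ∈ Z := fun x => Z.starProjection_apply_mem x
  have hz'Z : ∀ x, x - Z.starProjection x ∈ Zᗮ := fun x => Z.sub_starProjection_mem_orthogonal x
  have hzeq := isEquivariant_starProjection hZg
  -- Since `u` maps `Z` isometrically into itself, gluing it with the identity on `Zᗮ` gives an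
  -- equivariant isometry of `K`, which finiteness makes surjective.
  let T : K →L[ℂ] K := u ∘L Z.starProjection + (1 - Z.starProjection)
  have hTapp : ∀ x, T x = u (Z.starProjection x) + (x - Z.starProjection x) := fun x => rfl
  have hT : IsEquivariant U T := by
    intro g x
    rw [hTapp, hTapp, hzeq, hug g _ (hZD (hzZ x)), map_add, map_sub]
  have hTiso : ∀ x, ‖T x‖ = ‖x‖ := by
    intro x
    have e₁ := norm_add_sq_eq_norm_sq_add_norm_sq_of_inner_eq_zero _ _
      ((Submodule.mem_orthogonal _ _).mp (hz'Z x) _ (huZ _ (hzZ x)))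
    have e₂ := norm_add_sq_eq_norm_sq_add_norm_sq_of_inner_eq_zero _ _
      ((Submodule.mem_orthogonal _ _).mp (hz'Z x) _ (hzZ x))
    rw [hun _ (hZD (hzZ x)), ← e₂, ← hTapp, add_sub_cancel] at e₁
    exact (mul_self_inj (norm_nonneg _) (norm_nonneg _)).mp e₁
  rw [eq_bot_iff]
  intro x hx
  obtain ⟨w, hw⟩ := hT.surjective_of_isometry he hTiso x
  rw [hTapp] at hw
  -- As `x ∈ Rᗮ ≤ Z`, the preimage `w` has no component in `Zᗮ`; then `x` is a value of `u` on `D`,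
  -- hence in `R ∩ Rᗮ`.
  have h0 : w - Z.starProjection w = 0 := by
    rw [← inner_self_eq_zero (𝕜 := ℂ)]
    refine (Submodule.mem_orthogonal _ _).mp (hz'Z w) _ ?_
    rw [eq_sub_of_add_eq' hw]
    exact Z.sub_mem (hRZ hx) (huZ _ (hzZ w))
  rw [h0, add_zero] at hw
  rw [Submodule.mem_bot, ← inner_self_eq_zero (𝕜 := ℂ)]
  refine (Submodule.mem_orthogonal _ _).mp hx x ?_
  rw [← hw]
  exact huR _ (hZD (hzZ w))

/-- Polar decomposition with a unitary factor: in a finite multiple of the regular representation,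
every equivariant operator is `u |T|` with `u` unitary and equivariant. -/
theorem IsEquivariant.exists_unitary_polar (he : ∀ g p, U g (e p) = e (g * p.1, p.2))
    {T : K →L[ℂ] K} (hT : IsEquivariant U T) :
    ∃ u : K ≃ₗᵢ[ℂ] K, (∀ g x, u (U g x) = U g (u x)) ∧ ∀ x, u (CFC.abs T x) = T x := by
  obtain ⟨E, hle, hE⟩ := (isIsometricRelation_polar hT).exists_maximal
  have hswap := maximal_comap_swap hE
  have hfst : E.map (LinearMap.fst ℂ K K) = ⊤ := by
    have : CompleteSpace (E.map (LinearMap.fst ℂ K K)) :=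
      (isClosed_fst_of_maximal hE).completeSpace_coe
    rw [← Submodule.orthogonal_eq_bot_iff, ← orthogonal_snd_of_maximal he hswap]
    congr 1
    ext x
    constructor
    · rintro ⟨p, hp, rfl⟩
      exact ⟨p.swap, by simpa using hp, rfl⟩
    · rintro ⟨p, hp, rfl⟩
      exact ⟨p.swap, by simpa using hp, rfl⟩
  obtain ⟨u, hu⟩ := exists_partialIsometry hE
  have hmem : ∀ x, (x, u x) ∈ E := by
    intro x
    obtain ⟨p, hp, rfl⟩ : x ∈ E.map (LinearMap.fst ℂ K K) := hfst ▸ Submodule.mem_top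
    rw [LinearMap.fst_apply, hu p hp]
    exact hp
  have hequi : IsEquivariant U u := fun g x => hu _ (hE.1.invariant g _ (hmem x))
  have hiso : ∀ x, ‖u x‖ = ‖x‖ := fun x => (hE.1.norm_eq _ (hmem x)).symm
  refine ⟨LinearIsometryEquiv.ofSurjective ⟨u, hiso⟩ (hequi.surjective_of_isometry he hiso),
    hequi, fun x => ?_⟩
  exact hu _ (hle ⟨x, rfl⟩)

/-- The kernel of an equivariant operator is carried onto the orthogonal complement of its range
by an equivariant unitary. -/
theorem IsEquivariant.exists_unitary_ker (he : ∀ g p, U g (e p) = e (g * p.1, p.2))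
    {T : K →L[ℂ] K} (hT : IsEquivariant U T) :
    ∃ u : K ≃ₗᵢ[ℂ] K, (∀ g x, u (U g x) = U g (u x)) ∧ ∀ x, T x = 0 ↔ u x ∈ T.rangeᗮ := by
  obtain ⟨u, hu, hpolar⟩ := hT.exists_unitary_polar he
  refine ⟨u, hu, fun x => ?_⟩
  have key : ∀ y, inner ℂ (T y) (u x) = inner ℂ y (CFC.abs T x) := by
    intro y
    rw [← hpolar, u.inner_map_map, inner_cfcAbs_left]
  rw [Submodule.mem_orthogonal]
  constructor
  · rintro hx _ ⟨y, rfl⟩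
    have : CFC.abs T x = 0 := by rw [← norm_eq_zero, norm_cfcAbs_apply, hx, norm_zero]
    exact (key y).trans (by rw [this, inner_zero_right])
  · intro h
    have : CFC.abs T x = 0 := by
      rw [← inner_self_eq_zero (𝕜 := ℂ), ← key]
      exact h _ ⟨_, rfl⟩
    rw [← norm_eq_zero, ← norm_cfcAbs_apply, this, norm_zero]

end IsometricRelation

/-! ### Riesz bases as images of Hilbert bases. -/

section RieszBasis

open ContinuousLinearMap

variable {H K L : Type*} [NormedAddCommGroup H] [InnerProductSpace ℂ H]
  [NormedAddCommGroup K] [InnerProductSpace ℂ K] [NormedAddCommGroup L] [InnerProductSpace ℂ L]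
  {J : Type*}

theorem IsRieszBasisFor.mem {v : J → H} {V : Submodule ℂ H} (h : IsRieszBasisFor v V) (n : J) :
    v n ∈ V := by
  rw [h.1]
  exact Submodule.le_topologicalClosure _ (Submodule.subset_span ⟨n, rfl⟩)

theorem IsRieszBasisFor.isClosed {v : J → H} {V : Submodule ℂ H} (h : IsRieszBasisFor v V) :
    IsClosed (V : Set H) := by
  rw [h.1]
  exact Submodule.isClosed_topologicalClosure _

/-- A Riesz basis is the image of a Hilbert basis under a bounded injective operator. -/
theorem IsRieszBasisFor.exists_synthesis [CompleteSpace K] {v : J → H} {V : Submodule ℂ H}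
    (hv : IsRieszBasisFor v V) (e : HilbertBasis J ℂ K) :
    ∃ Φ : K →L[ℂ] H, (∀ n, Φ (e n) = v n) ∧ Φ.range = V ∧
      ∃ c > 0, ∀ x, c * ‖x‖ ≤ ‖Φ x‖ := by
  classical
  obtain ⟨A, B, hA, hB, hAB⟩ := hv.2
  have hnorm : ∀ x : K, HasSum (fun n => ‖e.repr x n‖ ^ 2) (‖x‖ ^ 2) := by
    intro x
    simp_rw [e.repr_apply_apply]
    exact e.hasSum_norm_sq x
  have hsum : ∀ x : K, Summable fun n => e.repr x n • v n := fun x =>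
    (hAB _ (hnorm x).summable).1
  let Φ₀ : K →ₗ[ℂ] H :=
    { toFun := fun x => ∑' n, e.repr x n • v n
      map_add' := fun x y => by
        rw [← (hsum x).tsum_add (hsum y)]
        simp [add_smul]
      map_smul' := fun c x => by
        rw [RingHom.id_apply, ← (hsum x).tsum_const_smul c]
        simp [mul_smul] }
  have hlow : ∀ x, √A * ‖x‖ ≤ ‖Φ₀ x‖ := by
    intro x
    have h := (hAB _ (hnorm x).summable).2.1
    rw [(hnorm x).tsum_eq] at h
    refine le_of_sq_le_sq ?_ (norm_nonneg _)
    rw [mul_pow, Real.sq_sqrt hA.le]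
    exact h
  have hup : ∀ x, ‖Φ₀ x‖ ≤ √B * ‖x‖ := by
    intro x
    have h := (hAB _ (hnorm x).summable).2.2
    rw [(hnorm x).tsum_eq] at h
    refine le_of_sq_le_sq ?_ (by positivity)
    rw [mul_pow, Real.sq_sqrt hB.le]
    exact h
  let Φ : K →L[ℂ] H := Φ₀.mkContinuous (√B) hup
  have hΦe : ∀ n, Φ (e n) = v n := by
    intro n
    change ∑' m, e.repr (e n) m • v m = v n
    rw [tsum_eq_single n, e.repr_self]
    · simp
    · intro m hm
      simp [e.repr_self, lp.single_apply, hm]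
  have hcl : IsClosed (Φ.range : Set H) := by
    have hanti : AntilipschitzWith (√A)⁻¹.toNNReal Φ :=
      Φ.antilipschitz_of_bound fun x => by
        rw [Real.coe_toNNReal _ (by positivity), inv_mul_eq_div, le_div_iff₀ (by positivity),
          mul_comm]
        exact hlow x
    exact hanti.isClosed_range Φ.uniformContinuous
  refine ⟨Φ, hΦe, le_antisymm ?_ ?_, √A, by positivity, hlow⟩
  · rintro _ ⟨x, rfl⟩
    have hx : HasSum (fun n => e.repr x n • v n) (Φ x) := (hsum x).hasSum
    exact hv.isClosed.mem_of_tendsto hx (Filter.Eventually.of_forall fun s =>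
      V.sum_mem fun n _ => V.smul_mem _ (hv.mem n))
  · rw [hv.1]
    refine Submodule.topologicalClosure_minimal _ ?_ hcl
    rw [Submodule.span_le]
    rintro _ ⟨n, rfl⟩
    exact ⟨e n, hΦe n⟩

theorem Orthonormal.hasSum_smul [CompleteSpace K] {b : J → K} (hb : Orthonormal ℂ b) {a : J → ℂ}
    (ha : Summable fun n => ‖a n‖ ^ 2) :
    ∃ x, HasSum (fun n => a n • b n) x ∧ ‖x‖ ^ 2 = ∑' n, ‖a n‖ ^ 2 := by
  have hmem : Memℓp a 2 := by
    refine memℓp_gen ?_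
    simpa using ha
  let f : lp (fun _ : J => ℂ) 2 := ⟨a, hmem⟩
  refine ⟨hb.orthogonalFamily.linearIsometry f, ?_, ?_⟩
  · simpa using hb.orthogonalFamily.hasSum_linearIsometry f
  · rw [LinearIsometry.norm_map]
    simpa using lp.norm_rpow_eq_tsum (p := 2) (by simp) f

/-- The image of an orthonormal family under an operator that is bounded below on its closed span
is a Riesz basis. -/
theorem Orthonormal.isRieszBasisFor [CompleteSpace K] {b : J → K} (hb : Orthonormal ℂ b)
    (Φ : K →L[ℂ] H) {c : ℝ} (hc : 0 < c) {W : Submodule ℂ H} (hW : IsClosed (W : Set H))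
    (hmap : (Submodule.span ℂ (Set.range b)).topologicalClosure.map (Φ : K →ₗ[ℂ] H) = W)
    (hlow : ∀ x ∈ (Submodule.span ℂ (Set.range b)).topologicalClosure, c * ‖x‖ ≤ ‖Φ x‖) :
    IsRieszBasisFor (fun n => Φ (b n)) W := by
  set N := (Submodule.span ℂ (Set.range b)).topologicalClosure with hN
  have hbN : ∀ n, b n ∈ N := fun n =>
    Submodule.le_topologicalClosure _ (Submodule.subset_span ⟨n, rfl⟩)
  -- The summand `1` keeps the upper constant positive when `Φ = 0`.
  refine ⟨le_antisymm ?_ ?_, c ^ 2, ‖Φ‖ ^ 2 + 1, by positivity, by positivity, fun a ha => ?_⟩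
  · rw [← hmap]
    rintro _ ⟨x, hx, rfl⟩
    refine map_mem_closure Φ.continuous hx fun y hy => ?_
    have hle : Submodule.span ℂ (Set.range b) ≤
        (Submodule.span ℂ (Set.range fun n => Φ (b n))).comap (Φ : K →ₗ[ℂ] H) := by
      rw [Submodule.span_le]
      rintro _ ⟨n, rfl⟩
      exact Submodule.subset_span ⟨n, rfl⟩
    exact hle hy
  · refine Submodule.topologicalClosure_minimal _ ?_ hW
    rw [Submodule.span_le, ← hmap]
    rintro _ ⟨n, rfl⟩
    exact ⟨b n, hbN n, rfl⟩
  · obtain ⟨x, hx, hxn⟩ := hb.hasSum_smul ha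
    have hxN : x ∈ N := (Submodule.isClosed_topologicalClosure _).mem_of_tendsto hx
      (Filter.Eventually.of_forall fun s => N.sum_mem fun n _ => N.smul_mem _ (hbN n))
    have hΦ : HasSum (fun n => a n • Φ (b n)) (Φ x) := by
      simpa using hx.mapL Φ
    rw [hΦ.tsum_eq, ← hxn]
    refine ⟨hΦ.summable, ?_, ?_⟩
    · rw [← mul_pow]
      exact pow_le_pow_left₀ (by positivity) (hlow x hxN) 2
    · calc ‖Φ x‖ ^ 2 ≤ (‖Φ‖ * ‖x‖) ^ 2 := pow_le_pow_left₀ (norm_nonneg _) (Φ.le_opNorm x) 2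
        _ ≤ (‖Φ‖ ^ 2 + 1) * ‖x‖ ^ 2 := by
          rw [mul_pow]
          gcongr
          exact le_add_of_nonneg_right zero_le_one

theorem HilbertBasis.exists_permutation [CompleteSpace K] (e : HilbertBasis J ℂ K)
    (σ : Equiv.Perm J) : ∃ P : K ≃ₗᵢ[ℂ] K, ∀ n, P (e n) = e (σ n) := by
  classical
  let e' : HilbertBasis J ℂ K := HilbertBasis.mk (e.orthonormal.comp σ σ.injective) (by
    rw [Set.range_comp, σ.range_eq_univ, Set.image_univ, e.dense_span])
  refine ⟨e.repr.trans e'.repr.symm, fun n => ?_⟩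
  rw [LinearIsometryEquiv.trans_apply, e.repr_self, e'.repr_symm_single, HilbertBasis.coe_mk]
  rfl

/-- This is the multiple of the left regular representation on which the trace argument operates. -/
theorem HilbertBasis.exists_translation [CompleteSpace K] {Γ ι : Type*} [Group Γ]
    (e : HilbertBasis (Γ × ι) ℂ K) :
    ∃ U : Γ →* (K ≃ₗᵢ[ℂ] K), ∀ g p, U g (e p) = e (g * p.1, p.2) := by
  choose P hP using fun g : Γ =>
    e.exists_permutation ((Equiv.mulLeft g).prodCongr (Equiv.refl ι))
  refine ⟨MonoidHom.mk' P fun g h => ?_, hP⟩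
  have h1 : (P (g * h) : K →L[ℂ] K) = (P g : K →L[ℂ] K) ∘L (P h : K →L[ℂ] K) :=
    e.clm_ext fun n => by
      change P (g * h) (e n) = P g (P h (e n))
      rw [hP, hP, hP]
      exact congrArg e (Prod.ext (mul_assoc _ _ _) rfl)
  ext x
  exact congr($h1 x)

/-- Restriction of coordinates along an injection of the index sets of two Hilbert bases. -/
theorem HilbertBasis.exists_coordinate_restriction [CompleteSpace K] [CompleteSpace L]
    {I : Type*} (e : HilbertBasis J ℂ K) (f : HilbertBasis I ℂ L) {σ : I → J}
    (hσ : Function.Injective σ) :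
    ∃ π : K →L[ℂ] L, (∀ n, π (e (σ n)) = f n) ∧ Function.Surjective π ∧
      ∀ x, π x = 0 ↔ ∀ n, inner ℂ (e (σ n)) x = 0 := by
  classical
  let i : L →ₗᵢ[ℂ] K := ((e.orthonormal.comp σ hσ).orthogonalFamily.linearIsometry).comp
    f.repr.toLinearIsometry
  have hi : ∀ n, i (f n) = e (σ n) := by
    intro n
    change (e.orthonormal.comp σ hσ).orthogonalFamily.linearIsometry (f.repr (f n)) = e (σ n)
    rw [f.repr_self, OrthogonalFamily.linearIsometry_apply_single]
    simp
  -- The adjoint of the isometric embedding `f n ↦ e (σ n)` is a left inverse of it and reads off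
  -- the coordinates along `σ`.
  let π : K →L[ℂ] L := adjoint i.toContinuousLinearMap
  have hπi : ∀ x, π (i x) = x := by
    intro x
    have h := (norm_map_iff_adjoint_comp_self i.toContinuousLinearMap).mp i.norm_map
    exact congr($h x)
  have hin : ∀ n x, inner ℂ (f n) (π x) = inner ℂ (e (σ n)) x := by
    intro n x
    rw [adjoint_inner_right, ← hi]
    rfl
  refine ⟨π, fun n => by rw [← hi, hπi], fun x => ⟨i x, hπi x⟩, fun x => ?_⟩
  simp_rw [← hin]
  constructor
  · intro h n
    rw [h, inner_zero_right]
  · intro h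
    have h2 := (f.hasSum_norm_sq (π x)).tsum_eq
    simp only [h, norm_zero, ne_eq, OfNat.ofNat_ne_zero, not_false_eq_true, zero_pow,
      tsum_zero] at h2
    exact norm_eq_zero.mp (sq_eq_zero_iff.mp h2.symm)

theorem ContinuousLinearMap.eq_zero_of_bounded_below (S : K →L[ℂ] H) {c : ℝ} (hc : 0 < c)
    (hS : ∀ x, c * ‖x‖ ≤ ‖S x‖) (x : K) (hx : S x = 0) : x = 0 := by
  have h := hS x
  rw [hx, norm_zero] at h
  exact norm_le_zero_iff.mp (nonpos_of_mul_nonpos_right h hc)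

/-- The factor is `S⁻¹ F`, bounded because `S` is bounded below. -/
theorem ContinuousLinearMap.exists_factor [CompleteSpace K] (S F : K →L[ℂ] H)
    {c : ℝ} (hc : 0 < c) (hS : ∀ x, c * ‖x‖ ≤ ‖S x‖) (hF : F.range ≤ S.range) :
    ∃ T : K →L[ℂ] K, ∀ x, S (T x) = F x := by
  choose t ht using fun x => hF ⟨x, rfl⟩
  have hinj : Function.Injective S :=
    (injective_iff_map_eq_zero S).mpr (S.eq_zero_of_bounded_below hc hS)
  have ht' : ∀ x, S (t x) = F x := ht
  let T₀ : K →ₗ[ℂ] K :=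
    { toFun := t
      map_add' := fun x y => hinj (by simp [ht'])
      map_smul' := fun a x => hinj (by simp [ht']) }
  refine ⟨T₀.mkContinuous (c⁻¹ * ‖F‖) fun x => ?_, ht'⟩
  rw [mul_assoc, inv_mul_eq_div, le_div_iff₀ hc, mul_comm]
  exact (hS (t x)).trans (by rw [ht']; exact F.le_opNorm x)

end RieszBasis

/-! ### Orbit families and invariant complements. -/

section Orbit

/-- The oblique projection onto a closed subspace `C` along a closed complement `A` commutes with
a representation leaving both invariant, and does not decrease norms on `Aᗮ`. -/
theorem exists_equivariant_projection {Γ K : Type*} [Group Γ] [NormedAddCommGroup K]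
    [InnerProductSpace ℂ K] [CompleteSpace K] {U : Γ →* (K ≃ₗᵢ[ℂ] K)} {A C : Submodule ℂ K}
    (hcompl : IsCompl C A) (hC : IsClosed (C : Set K)) (hA : IsClosed (A : Set K))
    (hAU : ∀ g, ∀ a ∈ A, U g a ∈ A) (hCU : ∀ g, ∀ a ∈ C, U g a ∈ C) :
    ∃ P : K →L[ℂ] K, IsEquivariant U P ∧ (∀ a, P a ∈ C) ∧
      (∀ a₀ ∈ A, ∀ a₁ ∈ C, P (a₀ + a₁) = a₁) ∧ ∀ a ∈ Aᗮ, ‖a‖ ≤ ‖P a‖ := by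
  have htop := Submodule.IsCompl.isTopCompl_of_isClosed hcompl hC hA
  let P : K →L[ℂ] K := C.projectionL A htop
  have hP : ∀ a₀ ∈ A, ∀ a₁ ∈ C, P (a₀ + a₁) = a₁ := by
    intro a₀ h₀ a₁ h₁
    rw [map_add, (Submodule.projectionL_apply_eq_zero_iff htop).mpr h₀, zero_add]
    exact Submodule.projectionL_apply_left htop ⟨a₁, h₁⟩
  have hdecomp : ∀ a, ∃ a₀ ∈ A, ∃ a₁ ∈ C, a₀ + a₁ = a := fun a => by
    have ha : a ∈ A ⊔ C := hcompl.symm.sup_eq_top ▸ Submodule.mem_top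
    exact Submodule.mem_sup.mp ha
  refine ⟨P, fun g a => ?_, fun a => Submodule.projectionL_apply_mem htop a, hP, fun a ha => ?_⟩
  · obtain ⟨a₀, h₀, a₁, h₁, rfl⟩ := hdecomp a
    rw [hP a₀ h₀ a₁ h₁, map_add, hP _ (hAU g a₀ h₀) _ (hCU g a₁ h₁)]
  · obtain ⟨a₀, h₀, a₁, h₁, hsum⟩ := hdecomp a
    -- Since `a ⊥ a₀`, Pythagoras gives `‖P a‖² = ‖a‖² + ‖a₀‖²`.
    have hPa : P a = a + -a₀ := by rw [← hsum, hP a₀ h₀ a₁ h₁]; abel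
    have hpyth := norm_add_sq_eq_norm_sq_add_norm_sq_of_inner_eq_zero a (-a₀)
      ((Submodule.mem_orthogonal' _ _).mp ha _ (A.neg_mem h₀))
    rw [hPa]
    refine le_of_sq_le_sq ?_ (norm_nonneg _)
    nlinarith [mul_self_nonneg ‖-a₀‖]

variable {H : Type*} [NormedAddCommGroup H] [InnerProductSpace ℂ H]
  (G : Subgroup (H ≃ₗᵢ[ℂ] H))

/-- A closed subspace with a Riesz basis of orbits is invariant under the group. -/
theorem IsRieszBasisFor.invariant {k : ℕ} {x : Fin k → H} {V : Submodule ℂ H}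
    (h : IsRieszBasisFor (orbitFamily G x) V) : ∀ g ∈ G, ∀ w ∈ V, g w ∈ V := by
  intro g hg w hw
  rw [h.1] at hw ⊢
  refine map_mem_closure g.continuous hw fun a ha => ?_
  have hle : Submodule.span ℂ (Set.range (orbitFamily G x)) ≤
      (Submodule.span ℂ (Set.range (orbitFamily G x))).comap
        (g.toLinearEquiv : H →ₗ[ℂ] H) := by
    rw [Submodule.span_le]
    rintro _ ⟨p, rfl⟩
    exact Submodule.subset_span ⟨(⟨g, hg⟩ * p.1, p.2), rfl⟩
  exact hle ha

variable {G}

theorem exists_orbit_rieszBasis_complement_of_hilbertBasis {K L : Type*}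
    [NormedAddCommGroup K] [InnerProductSpace ℂ K] [CompleteSpace K]
    [NormedAddCommGroup L] [InnerProductSpace ℂ L] [CompleteSpace L] {r k : ℕ}
    (e : HilbertBasis (G × Fin (r + k)) ℂ K) (f : HilbertBasis (G × Fin r) ℂ L) {x : Fin r → H}
    {y : Fin (r + k) → H} {V₀ V₁ W₀ : Submodule ℂ H}
    (hX : IsRieszBasisFor (orbitFamily G x) V₀) (hY : IsRieszBasisFor (orbitFamily G y) V₁)
    (hWclosed : IsClosed (W₀ : Set H)) (hinf : V₀ ⊓ W₀ = ⊥) (hsup : V₀ ⊔ W₀ = V₁)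
    (hW : ∀ g ∈ G, ∀ w ∈ W₀, g w ∈ W₀) :
    ∃ z : Fin k → H, IsRieszBasisFor (orbitFamily G z) W₀ := by
  obtain ⟨U, hU⟩ := e.exists_translation
  obtain ⟨S, hSe, hSrange, c, hc, hSlow⟩ := hY.exists_synthesis e
  obtain ⟨Φ, hΦf, hΦrange, c', hc', hΦlow⟩ := hX.exists_synthesis f
  -- `σ` and `τ` index the first `r` and the last `k` blocks of the basis of `K`.
  let σ : G × Fin r → G × Fin (r + k) := Prod.map id (Fin.castAdd k)
  let τ : G × Fin k → G × Fin (r + k) := Prod.map id (Fin.natAdd r)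
  have hσ : Function.Injective σ := Function.injective_id.prodMap (Fin.castAdd_injective r k)
  have hτ : Function.Injective τ := Function.injective_id.prodMap (Fin.natAdd_injective k r)
  have hστ : ∀ p q, σ p ≠ τ q := by
    intro p q h
    have h1 : (p.2 : ℕ) = r + q.2 := congrArg (fun t => (t.2 : ℕ)) h
    have := p.2.isLt
    omega
  obtain ⟨π, hπσ, hπsurj, hπker⟩ := e.exists_coordinate_restriction f hσ
  have hS0 := S.eq_zero_of_bounded_below hc hSlow
  have hΦ0 := Φ.eq_zero_of_bounded_below hc' hΦlow
  have hSinj : Function.Injective S := (injective_iff_map_eq_zero S).mpr hS0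
  have hV₀V₁ : V₀ ≤ V₁ := hsup ▸ le_sup_left
  have hW₀V₁ : W₀ ≤ V₁ := hsup ▸ le_sup_right
  have hFrange : (Φ ∘L π).range = V₀ := by
    rw [← hΦrange]
    ext v
    constructor
    · rintro ⟨a, rfl⟩
      exact ⟨π a, rfl⟩
    · rintro ⟨a, rfl⟩
      obtain ⟨b, rfl⟩ := hπsurj a
      exact ⟨b, rfl⟩
  -- `T = S⁻¹ Φ π` turns the comparison of the two families into a statement about one operator on
  -- `K`: its kernel sees the `k` spare blocks, its range is `S⁻¹ V₀`.
  obtain ⟨T, hT⟩ := S.exists_factor (Φ ∘L π) hc hSlow (by rw [hFrange, hSrange]; exact hV₀V₁)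
  have hSU : ∀ g a, S (U g a) = (g : H ≃ₗᵢ[ℂ] H) (S a) := by
    intro g
    have h : S ∘L (U g : K →L[ℂ] K) = ((g : H ≃ₗᵢ[ℂ] H) : H →L[ℂ] H) ∘L S := by
      refine e.clm_ext fun p => ?_
      change S (U g (e p)) = (g : H ≃ₗᵢ[ℂ] H) (S (e p))
      rw [hU, hSe, hSe]
      rfl
    exact fun a => congr($h a)
  have hπτ : ∀ q, π (e (τ q)) = 0 := by
    intro q
    rw [hπker]
    intro n
    exact e.orthonormal.inner_eq_zero (hστ n q)
  have hFU : ∀ g a, Φ (π (U g a)) = (g : H ≃ₗᵢ[ℂ] H) (Φ (π a)) := by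
    intro g
    have h : (Φ ∘L π) ∘L (U g : K →L[ℂ] K) =
        ((g : H ≃ₗᵢ[ℂ] H) : H →L[ℂ] H) ∘L (Φ ∘L π) := by
      refine e.clm_ext fun ⟨h, j⟩ => ?_
      change Φ (π (U g (e (h, j)))) = (g : H ≃ₗᵢ[ℂ] H) (Φ (π (e (h, j))))
      rw [hU]
      induction j using Fin.addCases with
      | left i =>
        change Φ (π (e (σ (g * h, i)))) = (g : H ≃ₗᵢ[ℂ] H) (Φ (π (e (σ (h, i)))))
        rw [hπσ, hπσ, hΦf, hΦf]
        rfl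
      | right i =>
        change Φ (π (e (τ (g * h, i)))) = (g : H ≃ₗᵢ[ℂ] H) (Φ (π (e (τ (h, i)))))
        rw [hπτ, hπτ, map_zero, map_zero]
    exact fun a => congr($h a)
  have hTeq : IsEquivariant U T := by
    intro g a
    apply hSinj
    rw [hSU, hT, hT]
    exact hFU g a
  obtain ⟨u, huU, huker⟩ := hTeq.exists_unitary_ker hU
  let A : Submodule ℂ K := V₀.comap (S : K →ₗ[ℂ] H)
  let C : Submodule ℂ K := W₀.comap (S : K →ₗ[ℂ] H)
  have hAclosed : IsClosed (A : Set K) := hX.isClosed.preimage S.continuous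
  have hCclosed : IsClosed (C : Set K) := hWclosed.preimage S.continuous
  have hTA : T.range = A := by
    ext a
    constructor
    · rintro ⟨b, rfl⟩
      change S (T b) ∈ V₀
      rw [hT, ← hFrange]
      exact ⟨b, rfl⟩
    · intro ha
      have ha' : S a ∈ (Φ ∘L π).range := by rw [hFrange]; exact ha
      obtain ⟨b, hb⟩ := ha'
      exact ⟨b, hSinj ((hT b).trans hb)⟩
  have lift : ∀ v ∈ V₁, ∃ a, S a = v := by
    intro v hv
    rw [← hSrange] at hv
    exact hv
  have hdecomp : ∀ a, ∃ a₀ ∈ A, ∃ a₁ ∈ C, a₀ + a₁ = a := by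
    intro a
    have ha : S a ∈ V₀ ⊔ W₀ := by
      rw [hsup, ← hSrange]
      exact ⟨a, rfl⟩
    obtain ⟨v, hv, w, hw, hvw⟩ := Submodule.mem_sup.mp ha
    obtain ⟨a₀, rfl⟩ := lift v (hV₀V₁ hv)
    obtain ⟨a₁, rfl⟩ := lift w (hW₀V₁ hw)
    exact ⟨a₀, hv, a₁, hw, hSinj (by rw [map_add, hvw])⟩
  have hcompl : IsCompl C A := by
    constructor
    · rw [Submodule.disjoint_def]
      intro a haC haA
      apply hS0
      have : S a ∈ V₀ ⊓ W₀ := ⟨haA, haC⟩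
      rwa [hinf] at this
    · rw [codisjoint_iff, eq_top_iff]
      intro a _
      obtain ⟨a₀, h₀, a₁, h₁, rfl⟩ := hdecomp a
      exact add_comm a₁ a₀ ▸ Submodule.add_mem_sup h₁ h₀
  obtain ⟨P, hPU, hPC, hP, hPlow⟩ := exists_equivariant_projection (U := U) hcompl hCclosed
    hAclosed (fun g a ha => by
      change S (U g a) ∈ V₀
      rw [hSU]
      exact hX.invariant G g g.2 _ ha) (fun g a ha => by
      change S (U g a) ∈ W₀
      rw [hSU]
      exact hW g g.2 _ ha)
  have hb : Orthonormal ℂ (e ∘ τ) := e.orthonormal.comp τ hτ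
  set N := (Submodule.span ℂ (Set.range (e ∘ τ))).topologicalClosure with hNdef
  have hTker : ∀ a, T a = 0 ↔ ∀ n, inner ℂ (e (σ n)) a = 0 := by
    intro a
    rw [← hπker]
    constructor
    · intro h
      apply hΦ0
      have := hT a
      rw [h, map_zero] at this
      exact this.symm
    · intro h
      apply hS0
      rw [hT, ContinuousLinearMap.comp_apply, h, map_zero]
  have hN : ∀ a, a ∈ N ↔ u a ∈ Aᗮ := by
    intro a
    rw [← hTA, ← huker]
    constructor
    · intro ha
      have hle : N ≤ (T : K →ₗ[ℂ] K).ker := by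
        refine Submodule.topologicalClosure_minimal _ ?_ T.isClosed_ker
        rw [Submodule.span_le]
        rintro _ ⟨q, rfl⟩
        exact (hTker _).mpr fun n => e.orthonormal.inner_eq_zero (hστ n q)
      exact hle ha
    · intro ha
      rw [hTker] at ha
      refine (Submodule.isClosed_topologicalClosure _).mem_of_tendsto (e.hasSum_repr a)
        (Filter.Eventually.of_forall fun s => N.sum_mem fun p _ => ?_)
      obtain ⟨g, j⟩ := p
      rw [e.repr_apply_apply]
      induction j using Fin.addCases with
      | left i =>
        have h0 : inner ℂ (e (g, Fin.castAdd k i)) a = 0 := ha (g, i)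
        rw [h0, zero_smul]
        exact N.zero_mem
      | right i =>
        exact N.smul_mem _
          (Submodule.le_topologicalClosure _ (Submodule.subset_span ⟨(g, i), rfl⟩))
  let Ψ : K →L[ℂ] H := S ∘L P ∘L (u : K →L[ℂ] K)
  have hΨ : ∀ a, Ψ a = S (P (u a)) := fun a => rfl
  have hriesz : IsRieszBasisFor (fun n => Ψ ((e ∘ τ) n)) W₀ := by
    refine hb.isRieszBasisFor Ψ hc hWclosed ?_ fun a ha => ?_
    · apply le_antisymm
      · rintro _ ⟨a, -, rfl⟩
        exact hPC (u a)
      · intro w hw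
        obtain ⟨a, rfl⟩ := lift w (hW₀V₁ hw)
        -- To reach `S a` with `a ∈ C`, split `a = a₀ + u b` orthogonally along `A`; then `P (u b) =
        -- P (-a₀ + a) = a`.
        have : CompleteSpace A := hAclosed.completeSpace_coe
        obtain ⟨a₀, h₀, a₁, h₁, rfl⟩ := A.exists_add_mem_mem_orthogonal a
        obtain ⟨b, rfl⟩ := u.surjective a₁
        refine ⟨b, (hN b).mpr h₁, ?_⟩
        change S (P (u b)) = S (a₀ + u b)
        congr 1
        have := hP (-a₀) (A.neg_mem h₀) _ hw
        rwa [neg_add_cancel_left] at this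
    · calc c * ‖a‖ = c * ‖u a‖ := by rw [u.norm_map]
        _ ≤ c * ‖P (u a)‖ := by
          gcongr
          exact hPlow _ ((hN a).mp ha)
        _ ≤ ‖Ψ a‖ := hSlow _
  refine ⟨fun j => Ψ (e (1, Fin.natAdd r j)), ?_⟩
  convert hriesz using 1
  ext ⟨g, j⟩
  -- Equivariance of `u` and `P` and the intertwining by `S` make the Riesz basis the `G`-orbits of
  -- its members at `g = 1`.
  have h1 : (e ∘ τ) (g, j) = U g (e (1, Fin.natAdd r j)) := by
    rw [hU, mul_one]
    rfl
  rw [h1, hΨ, huU, hPU, hSU]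
  rfl

/-- An invariant closed complement, inside a subspace with a Riesz basis of `r + k` orbits, of a
subspace with a Riesz basis of `r` orbits has a Riesz basis of `k` orbits. -/
theorem exists_orbit_rieszBasis_complement {r k : ℕ} {x : Fin r → H}
    {y : Fin (r + k) → H} {V₀ V₁ W₀ : Submodule ℂ H}
    (hX : IsRieszBasisFor (orbitFamily G x) V₀) (hY : IsRieszBasisFor (orbitFamily G y) V₁)
    (hWclosed : IsClosed (W₀ : Set H)) (hinf : V₀ ⊓ W₀ = ⊥) (hsup : V₀ ⊔ W₀ = V₁)
    (hW : ∀ g ∈ G, ∀ w ∈ W₀, g w ∈ W₀) :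
    ∃ z : Fin k → H, IsRieszBasisFor (orbitFamily G z) W₀ :=
  exists_orbit_rieszBasis_complement_of_hilbertBasis
    (K := lp (fun _ : G × Fin (r + k) => ℂ) 2) (L := lp (fun _ : G × Fin r => ℂ) 2)
    ⟨LinearIsometryEquiv.refl ℂ _⟩ ⟨LinearIsometryEquiv.refl ℂ _⟩ hX hY hWclosed hinf hsup hW

end Orbit

theorem theorem3p1 {H : Type*} [NormedAddCommGroup H] [InnerProductSpace ℂ H] [CompleteSpace H]
    [TopologicalSpace.SeparableSpace H]
    (G : Subgroup (H ≃ₗᵢ[ℂ] H)) (hGcount : Countable G) (hGinf : Infinite G)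
    (hGcomm : ∀ g ∈ G, ∀ h ∈ G, g * h = h * g)
    (r s : ℕ) (hrs : r < s) (x : Fin r → H) (y : Fin s → H)
    (V₀ V₁ W₀ : Submodule ℂ H)
    (hX : IsRieszBasisFor (orbitFamily G x) V₀)
    (hY : IsRieszBasisFor (orbitFamily G y) V₁)
    (hV : V₀ ≤ V₁)
    (hWclosed : IsClosed (W₀ : Set H))
    (hinf : V₀ ⊓ W₀ = ⊥) (hsup : V₀ ⊔ W₀ = V₁) :
    (∃ z : Fin (s - r) → H, (∀ j, z j ∈ W₀) ∧ IsRieszBasisFor (orbitFamily G z) W₀) ↔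
      ∀ g ∈ G, ∀ w ∈ W₀, g w ∈ W₀ := by
  constructor
  · rintro ⟨z, -, hz⟩
    exact hz.invariant G
  · intro hW
    obtain ⟨k, rfl⟩ := Nat.exists_eq_add_of_le hrs.le
    rw [Nat.add_sub_cancel_left]
    obtain ⟨z, hz⟩ := exists_orbit_rieszBasis_complement hX hY hWclosed hinf hsup hW
    exact ⟨z, fun j => hz.mem (1, j), hz⟩
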